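/- Let $n\ge 1$, let $r,s\ge 0$ be integers, and let $\eta=(n_1,\dots,n_r;m_1,\dots,m_s)$ be positive integers with $(n_1+\dots+n_r)+2(m_1+\dots+m_s)=n$ (either list may be empty). Let $\mathbb{T}_m(\mathbb{R})$ be the set of lower triangular real $m\times m$ matrices whose diagonal entries are all equal. Let $\mathbb{S}$ be the set of real matrices $\begin{bmatrix}\alpha&\beta\\-\beta&\alpha\end{bmatrix}$, and let $\mathbb{B}_m(\mathbb{R})$ be the set of real $2m\times 2m$ matrices that, written in $2\times2$ blocks, have all blocks in $\mathbb{S}$, are block lower triangular, and have all diagonal blocks equal. Let $\mathcal{K}_{\eta,r,s}(\mathbb{R})$ be the set of block diagonal matrices $\mathrm{diag}(T_1,\dots,T_r;B_1,\dots,B_s)$ of order $n$ with $T_k\in\mathbb{T}_{n_k}(\mathbb{R})$ and $B_l\in\mathbb{B}_{m_l}(\mathbb{R})$. Let $G$ be an abelian sub-semigroup of $M_n(\mathbb{R})$ (under multiplication) and let $P\in\mathrm{GL}(n,\mathbb{R})$ be such that $P^{-1}GP\subset\mathcal{K}_{\eta,r,s}(\mathbb{R})$. Put: - $G(v)=\{Av: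 A\in G\}$ for $v\in\mathbb{R}^n$; $G$ is called hypercyclic if $G(v)$ is dense in $\mathbb{R}^n$ for some $v\in\mathbb{R}^n$; - $v_0=Pu_0$, where $u_0\in\mathbb{R}^n$ is the vector whose component in each of the $r+s$ blocks $\mathbb{R}^{n_k}$, $\mathbb{R}^{2m_l}$ is $[1,0,\dots,0]^T$; - $\mathrm{g}=\{B\in P\,\mathcal{K}_{\eta,r,s}(\mathbb{R})\,P^{-1}: e^B\in G\}$ and $\mathrm{g}_{v_0}=\{Bv_0: B\in\mathrm{g}\}$; - $\mathrm{ind}(G)$ is the number of $k\in\{1,\dots,r\}$ for which there is an invertible $A\in G$ such that, writing $P^{-1}AP=\mathrm{diag}(M_1,\dots,M_r;\widetilde M_1,\dots,\widetilde M_s)$ and denoting by $\mu_i$ the unique eigenvalue of $M_i$, one has $\mu_k<0$ and $\mu_i>0$ for all $i\ne k$ (so $\mathrm{ind}(G)=0$ if $r=0$). Then the following are equivalent: 1. $G$ is hypercyclic; 2. $G(v_0)$ is dense in $\mathbb{R}^n$; 3. $\mathrm{g}_{v_0}$ is an additive sub-semigroup dense in $\mathbb{R}^n$, and $\mathrm{ind}(G)=r$.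 -/

import Mathlib

noncomputable section

namespace HypercyclicNormalForm

/-- The block sizes `η = (n₁, …, n_r; m₁, …, m_s)`: positive integers with
`(n₁ + ⋯ + n_r) + 2 (m₁ + ⋯ + m_s) = n`. Either list may be empty. -/
structure BlockSizes (n r s : ℕ) where
  /-- the sizes `n₁, …, n_r` of the real blocks -/
  realSize : Fin r → ℕ
  /-- the half-sizes `m₁, …, m_s` of the complex blocks -/
  cplxSize : Fin s → ℕ
  realSize_pos : ∀ k, 0 < realSize k
  cplxSize_pos : ∀ l, 0 < cplxSize l
  sum_eq : ∑ k, realSize k + 2 * ∑ l, cplxSize l = n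

/-- The matrices of order `m` that are lower triangular with constant diagonal. -/
def lowerTri (m : ℕ) : Set (Matrix (Fin m) (Fin m) ℝ) :=
  {M | (∀ i j, i < j → M i j = 0) ∧ ∀ i j, M i i = M j j}

/-- The `2 × 2` matrices with rows `(α, β)` and `(-β, α)`. -/
def cplxMat : Set (Matrix (Fin 2) (Fin 2) ℝ) :=
  {C | ∃ α β : ℝ, C = !![α, β; -β, α]}

/-- The `2 × 2` block at place `(i, j)` of a matrix of order `2m`. -/
def subBlock {m : ℕ} (M : Matrix (Fin m × Fin 2) (Fin m × Fin 2) ℝ) (i j : Fin m) :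
    Matrix (Fin 2) (Fin 2) ℝ :=
  Matrix.of fun a b => M (i, a) (j, b)

/-- The matrices of order `2m` whose `2 × 2` blocks all lie in `cplxMat`, which are block lower
triangular, and whose diagonal `2 × 2` blocks are all equal. -/
def lowerTriCplx (m : ℕ) : Set (Matrix (Fin m × Fin 2) (Fin m × Fin 2) ℝ) :=
  {M | (∀ i j, subBlock M i j ∈ cplxMat) ∧ (∀ i j, i < j → subBlock M i j = 0) ∧
    ∀ i j, subBlock M i i = subBlock M j j}

namespace BlockSizes

variable {n r s : ℕ}

/-- Coordinates sorted by blocks: a place in a real block, or a place in a complex block (given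
by the number of the `2 × 2` block and the place in it). -/
abbrev Index (η : BlockSizes n r s) : Type :=
  (Σ k : Fin r, Fin (η.realSize k)) ⊕ (Σ l : Fin s, Fin (η.cplxSize l) × Fin 2)

theorem sum_eq' (η : BlockSizes n r s) :
    ∑ k, η.realSize k + ∑ l, η.cplxSize l * 2 = n := by
  rw [← Finset.sum_mul, mul_comm]
  exact η.sum_eq

/-- The numbering of the coordinates of `ℝⁿ` in which the blocks follow each other in the order
given by `η`. -/
def indexEquiv (η : BlockSizes n r s) : η.Index ≃ Fin n :=
  (Equiv.sumCongr finSigmaFinEquiv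
    ((Equiv.sigmaCongrRight fun _ => finProdFinEquiv).trans finSigmaFinEquiv)).trans
    (finSumFinEquiv.trans (finCongr η.sum_eq'))

/-- `𝒦_{η,r,s}(ℝ)`: the matrices of order `n` of the form
`diag(T₁, …, T_r; B₁, …, B_s)` with `T_k ∈ 𝕋_{n_k}(ℝ)` and `B_l ∈ 𝔹_{m_l}(ℝ)`. -/
def normalForm (η : BlockSizes n r s) : Set (Matrix (Fin n) (Fin n) ℝ) :=
  {M | ∃ (T : ∀ k, Matrix (Fin (η.realSize k)) (Fin (η.realSize k)) ℝ)
      (B : ∀ l, Matrix (Fin (η.cplxSize l) × Fin 2) (Fin (η.cplxSize l) × Fin 2) ℝ),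
      (∀ k, T k ∈ lowerTri (η.realSize k)) ∧ (∀ l, B l ∈ lowerTriCplx (η.cplxSize l)) ∧
      M = Matrix.reindex η.indexEquiv η.indexEquiv
        (Matrix.fromBlocks (Matrix.blockDiagonal' T) 0 0 (Matrix.blockDiagonal' B))}

/-- The `k`-th real diagonal block of a matrix of order `n`. -/
def realBlock (η : BlockSizes n r s) (M : Matrix (Fin n) (Fin n) ℝ) (k : Fin r) :
    Matrix (Fin (η.realSize k)) (Fin (η.realSize k)) ℝ :=
  Matrix.of fun a b => M (η.indexEquiv (Sum.inl ⟨k, a⟩)) (η.indexEquiv (Sum.inl ⟨k, b⟩))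

/-- The vector `u₀` whose restriction to every (real or complex) block is `(1, 0, …, 0)`. -/
def u₀ (η : BlockSizes n r s) : Fin n → ℝ := fun i =>
  match η.indexEquiv.symm i with
  | Sum.inl ⟨_, a⟩ => if (a : ℕ) = 0 then 1 else 0
  | Sum.inr ⟨_, (a, b)⟩ => if (a : ℕ) = 0 ∧ (b : ℕ) = 0 then 1 else 0

/-- `v₀ = P u₀`. -/
def v₀ (η : BlockSizes n r s) (P : GL (Fin n) ℝ) : Fin n → ℝ :=
  (P : Matrix (Fin n) (Fin n) ℝ).mulVec η.u₀

/-- `g = exp⁻¹(G) ∩ P 𝒦_{η,r,s}(ℝ) P⁻¹`. -/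
def logSet (η : BlockSizes n r s) (P : GL (Fin n) ℝ)
    (G : Subsemigroup (Matrix (Fin n) (Fin n) ℝ)) : Set (Matrix (Fin n) (Fin n) ℝ) :=
  {B | NormedSpace.exp B ∈ G} ∩
    {B | ∃ C ∈ η.normalForm, B = (P : Matrix (Fin n) (Fin n) ℝ) * C *
      ((P⁻¹ : GL (Fin n) ℝ) : Matrix (Fin n) (Fin n) ℝ)}

/-- `g_u = {B u : B ∈ g}`. -/
def logOrbit (η : BlockSizes n r s) (P : GL (Fin n) ℝ)
    (G : Subsemigroup (Matrix (Fin n) (Fin n) ℝ)) (u : Fin n → ℝ) : Set (Fin n → ℝ) :=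
  {x | ∃ B ∈ η.logSet P G, x = B.mulVec u}

/-- `ind(G)`: the number of `k ∈ {1, …, r}` for which there is an invertible `A ∈ G` such that
the real blocks of `P⁻¹ A P` have eigenvalues `μ₁, …, μ_r` with `μ_k < 0` and `μ_i > 0` for all
`i ≠ k`. (A real block of a matrix in normal form has exactly one eigenvalue. For `r = 0` this
number is `0`; for `r = 1` the condition on `i ≠ k` is empty.) -/
def ind (η : BlockSizes n r s) (P : GL (Fin n) ℝ)
    (G : Subsemigroup (Matrix (Fin n) (Fin n) ℝ)) : ℕ :=
  Set.ncard {k : Fin r | ∃ A ∈ G, IsUnit A ∧ ∃ μ : Fin r → ℝ,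
    (∀ i, Module.End.HasEigenvalue (Matrix.toLin' (η.realBlock
      (((P⁻¹ : GL (Fin n) ℝ) : Matrix (Fin n) (Fin n) ℝ) * A *
        (P : Matrix (Fin n) (Fin n) ℝ)) i)) (μ i)) ∧
    μ k < 0 ∧ ∀ i, i ≠ k → 0 < μ i}

end BlockSizes

/-- The orbit `G(v) = {A v : A ∈ G}`. -/
def orbit {n : ℕ} (G : Subsemigroup (Matrix (Fin n) (Fin n) ℝ)) (v : Fin n → ℝ) :
    Set (Fin n → ℝ) :=
  {x | ∃ A ∈ G, x = A.mulVec v}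

/-- `G` is hypercyclic if it has a dense orbit. -/
def IsHypercyclic {n : ℕ} (G : Subsemigroup (Matrix (Fin n) (Fin n) ℝ)) : Prop :=
  ∃ v : Fin n → ℝ, Dense (orbit G v)

end HypercyclicNormalForm

end

/-! ### The exponential in real Banach algebras: commutation, openness, unipotent logarithms. -/

section BanachAlgebra

open NormedSpace Topology Filter

variable {𝔸 : Type*} [NormedRing 𝔸] [NormedAlgebra ℝ 𝔸]

/-! If a commuting set of matrices has a dense orbit at `v`, its span carries `v` to every vector.
Evaluation at `v` is then an isomorphism from the centralizer onto the whole space, and the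
centralizer equals the span, hence is commutative (`centralizerEquiv`,
`commute_of_mem_centralizer`). Density of orbits thus becomes density in a commutative algebra,
where `exp` is open (`isOpenMap_exp_of_forall_commute`).

Each element of `P 𝒦 P⁻¹` is a central scalar from `ℝ^r × ℂ^s` plus a nilpotent (`ScalarSplitting`).
The ambiguity of logarithms sits in the central part, so the logarithms of elements of `G` commute
with `G` and with each other; in particular they add.

1 → 2: some invertible matrix in the span of `G` carries the hypercyclic vector to `v₀`. 2 → 3: pull
`G` back along the open map `exp`; the sign patterns of `ind` are open conditions. 3 → 2:
exponentials of logarithms approximate the elements with positive real and nonzero complex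
coordinates, the matrices counted by `ind` flip one sign at a time, and elements with no zero
coordinate are dense. -/

theorem pow_mul_eq_of_commutator_commutes {N Y Z : 𝔸} (hZ : N * Y = Y * N + Z) (hNZ : Commute N Z)
    (k : ℕ) : N ^ (k + 1) * Y = Y * N ^ (k + 1) + ((k + 1 : ℕ) : ℝ) • (N ^ k * Z) := by
  induction k with
  | zero => simpa using hZ
  | succ k ih =>
    rw [pow_succ' N (k + 1), mul_assoc, ih, mul_add, ← mul_assoc, hZ, mul_smul_comm, ← mul_assoc,
      ← pow_succ', add_mul, (hNZ.pow_left (k + 1)).symm.eq, mul_assoc, add_assoc]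
    congr 1
    push_cast
    module

variable [CompleteSpace 𝔸]

theorem exp_add_of_commute_real {x y : 𝔸} (h : Commute x y) : exp (x + y) = exp x * exp y :=
  letI := NormedAlgebra.restrictScalars ℚ ℝ 𝔸
  exp_add_of_commute h

theorem isUnit_exp_real (x : 𝔸) : IsUnit (exp x) :=
  letI := NormedAlgebra.restrictScalars ℚ ℝ 𝔸
  isUnit_exp x

theorem exp_mul_eq_of_commutator_commutes {N Y Z : 𝔸} (hZ : N * Y = Y * N + Z)
    (hNZ : Commute N Z) : exp N * Y = Y * exp N + exp N * Z := by
  have h := exp_series_hasSum_exp' (𝕂 := ℝ) N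
  have h1 := (h.mul_right Y).sub (h.mul_left Y)
  have h2 := h.mul_right Z
  have h3 : HasSum (fun n : ℕ => ((n.factorial : ℝ)⁻¹ • N ^ n) * Y - Y * ((n.factorial : ℝ)⁻¹ • N ^ n))
      (exp N * Z) := by
    -- The zeroth commutator vanishes; after the shift, `(k + 1) / (k + 1)! = 1 / k!` leaves the
    -- series of `exp N * Z`.
    rw [← hasSum_nat_add_iff' 1]
    simp only [Finset.range_one, Finset.sum_singleton, pow_zero, smul_mul_assoc, mul_smul_comm,
      one_mul, mul_one, sub_self, sub_zero]
    refine Eq.subst (motive := fun f => HasSum f _) (funext fun k => ?_) h2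
    symm
    rw [← smul_sub, pow_mul_eq_of_commutator_commutes hZ hNZ, add_sub_cancel_left, smul_smul,
      Nat.factorial_succ, smul_mul_assoc]
    congr 1
    have : (k.factorial : ℝ) ≠ 0 := by positivity
    push_cast
    field_simp
  rw [← h1.unique h3]
  abel

/-- `ad N` is nilpotent, so induct on the power of it that kills `Y`. The commutator `Z = N * Y - Y
* N` is killed one step earlier and still commutes with `exp N`, hence with `N`. Then `exp N * Z =
exp N * Y - Y * exp N = 0`, and `exp N` is a unit. -/
theorem commute_of_commute_exp {N X : 𝔸} (hN : IsNilpotent N) (h : Commute (exp N) X) :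
    Commute N X := by
  obtain ⟨p, hp⟩ : IsNilpotent (LinearMap.mulLeft ℝ N - LinearMap.mulRight ℝ N) :=
    (LinearMap.commute_mulLeft_right (R := ℝ) N N).isNilpotent_sub
      ((LinearMap.isNilpotent_mulLeft_iff ℝ N).2 hN) ((LinearMap.isNilpotent_mulRight_iff ℝ N).2 hN)
  suffices H : ∀ (p : ℕ) (Y : 𝔸), Commute (exp N) Y → ((LinearMap.mulLeft ℝ N - LinearMap.mulRight ℝ N) ^ p) Y = 0 →
      Commute N Y from H p X h (by rw [hp]; rfl)
  intro p
  induction p with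
  | zero =>
    intro Y _ h0
    have : Y = 0 := by simpa using h0
    rw [this]
    exact Commute.zero_right N
  | succ p ih =>
    intro Y hY h0
    rw [pow_succ, Module.End.mul_apply] at h0
    have hself : Commute (exp N) N := (Commute.refl N).exp_left
    have hZ : Commute N (N * Y - Y * N) :=
      ih _ ((hself.mul_right hY).sub_right (hY.mul_right hself)) h0
    have h1 := exp_mul_eq_of_commutator_commutes (N := N) (Y := Y) (by abel) hZ
    rw [hY.eq, left_eq_add] at h1
    have h2 := (isUnit_exp_real N).mul_right_eq_zero.1 h1
    exact sub_eq_zero.1 h2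

/-- The inverse function theorem gives openness at `0`; `exp x = exp a * exp (x - a)` with `exp a` a
unit transports it to `a`. -/
theorem isOpenMap_exp_of_forall_commute (hc : ∀ a b : 𝔸, Commute a b) :
    IsOpenMap (exp : 𝔸 → 𝔸) := by
  rw [isOpenMap_iff_nhds_le]
  intro a
  have h0 : map (exp : 𝔸 → 𝔸) (𝓝 0) = 𝓝 1 := by
    have h : HasStrictFDerivAt (exp : 𝔸 → 𝔸)
      ((ContinuousLinearEquiv.refl ℝ 𝔸 : 𝔸 ≃L[ℝ] 𝔸) : 𝔸 →L[ℝ] 𝔸) 0 := hasStrictFDerivAt_exp_zero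
    simpa using h.map_nhds_eq_of_equiv
  have h1 : (exp : 𝔸 → 𝔸) = (fun x => exp a * x) ∘ exp ∘ (fun x => x - a) := by
    funext x
    simp only [Function.comp]
    rw [← exp_add_of_commute_real (hc _ _), add_sub_cancel]
  have h2 : map (fun x : 𝔸 => x - a) (𝓝 a) = 𝓝 0 := by
    rw [← sub_self a]
    exact (Homeomorph.subRight a).map_nhds_eq a
  obtain ⟨u, hu⟩ := isUnit_exp_real a
  have h3 : map (fun x : 𝔸 => exp a * x) (𝓝 1) = 𝓝 (exp a) := by
    have := (Homeomorph.mk (Units.mulLeft u) (by simpa using continuous_const_mul _)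
      (by simpa using continuous_const_mul _)).map_nhds_eq 1
    simpa [hu] using this
  conv_rhs => rw [h1]
  rw [← map_map, ← map_map, h2, h0, h3]

/-- The set of `t` for which `1 + t • N` is an exponential contains `0` and is clopen. It is closed
because `1 + t • N` is a unit, so nearby points of the line differ from it by an exponential factor.
-/
theorem exists_exp_eq_one_add_of_isNilpotent (hc : ∀ a b : 𝔸, Commute a b) {N : 𝔸}
    (hN : IsNilpotent N) : ∃ y, exp y = 1 + N := by
  have hU : IsOpen (Set.range (exp : 𝔸 → 𝔸)) := (isOpenMap_exp_of_forall_commute hc).isOpen_range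
  have hf : Continuous fun t : ℝ => 1 + t • N := by fun_prop
  have hclopen : IsClopen ((fun t : ℝ => 1 + t • N) ⁻¹' Set.range (exp : 𝔸 → 𝔸)) := by
    refine ⟨⟨isOpen_iff_mem_nhds.2 fun t ht => ?_⟩, hU.preimage hf⟩
    obtain ⟨u, hu⟩ : IsUnit (1 + t • N) := (hN.smul t).isUnit_one_add
    have h1 : Tendsto (fun x : ℝ => (↑u⁻¹ : 𝔸) * (1 + x • N)) (𝓝 t) (𝓝 (exp 0)) := by
      have h2 := (continuous_const (y := (↑u⁻¹ : 𝔸)).mul hf).tendsto t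
      have h3 : (↑u⁻¹ : 𝔸) * (1 + t • N) = exp 0 := by rw [← hu, u.inv_mul, exp_zero]
      exact h3 ▸ h2
    filter_upwards [h1.eventually (hU.mem_nhds ⟨0, rfl⟩)]
    rintro x ⟨y, hy⟩ ⟨z, hz⟩
    refine ht ⟨z + -y, ?_⟩
    rw [exp_add_of_commute_real (hc _ _), hz]
    show (1 + x • N) * exp (-y) = 1 + t • N
    have h2 : (1 + x • N) = u * exp y := by rw [hy, Units.mul_inv_cancel_left]
    rw [h2, mul_assoc, ← exp_add_of_commute_real (hc _ _), add_neg_cancel, exp_zero, mul_one, hu]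
  have huniv := hclopen.eq_univ ⟨0, 0, by simp⟩
  obtain ⟨y, hy⟩ : (1 : ℝ) ∈ (fun t : ℝ => 1 + t • N) ⁻¹' Set.range (exp : 𝔸 → 𝔸) :=
    huniv ▸ Set.mem_univ _
  exact ⟨y, by simpa using hy⟩

end BanachAlgebra

/-! ### Transfer to subalgebras and to matrices. -/

section MapExp

open NormedSpace

theorem map_exp_real {𝔸 𝔹 : Type*} [NormedRing 𝔸] [NormedAlgebra ℝ 𝔸] [CompleteSpace 𝔸]
    [NormedRing 𝔹] [NormedAlgebra ℝ 𝔹] (f : 𝔸 →ₐ[ℝ] 𝔹) (hf : Continuous f) (x : 𝔸) :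
    f (exp x) = exp (f x) :=
  letI := NormedAlgebra.restrictScalars ℚ ℝ 𝔸
  letI := NormedAlgebra.restrictScalars ℚ ℝ 𝔹
  map_exp f hf x

section Subalgebra

variable {𝔸 : Type*} [NormedRing 𝔸] [NormedAlgebra ℝ 𝔸] [FiniteDimensional ℝ 𝔸]

theorem Subalgebra.exists_exp_eq_one_add_of_isNilpotent {A : Subalgebra ℝ 𝔸}
    (hc : ∀ X ∈ A, ∀ Y ∈ A, Commute X Y) {N : 𝔸} (hNA : N ∈ A) (hN : IsNilpotent N) :
    ∃ Y ∈ A, exp Y = 1 + N := by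
  have : CompleteSpace A := FiniteDimensional.complete ℝ A
  obtain ⟨y, hy⟩ := _root_.exists_exp_eq_one_add_of_isNilpotent (𝔸 := A)
    (fun a b => Subtype.ext (hc a a.2 b b.2)) (N := ⟨N, hNA⟩)
    ((IsNilpotent.map_iff (f := A.val) Subtype.val_injective).1 hN)
  refine ⟨y, y.2, ?_⟩
  rw [← A.val_apply, ← map_exp_real A.val continuous_subtype_val, hy]
  rfl

/-- Density is relative to `A`, since `exp` is known to be open only on the commutative algebra;
preimages of dense sets under open maps are dense. -/
theorem Subalgebra.dense_setOf_exp_mem {A : Subalgebra ℝ 𝔸} (hc : ∀ X ∈ A, ∀ Y ∈ A, Commute X Y)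
    {U : Set 𝔸} (hU : Dense {X : A | (X : 𝔸) ∈ U}) : Dense {X : A | exp (X : 𝔸) ∈ U} := by
  have : CompleteSpace A := FiniteDimensional.complete ℝ A
  refine (hU.preimage (isOpenMap_exp_of_forall_commute (𝔸 := A) fun a b =>
    Subtype.ext (hc a a.2 b b.2))).mono fun X hX => ?_
  rw [Set.mem_ofPred_eq, ← A.val_apply, ← map_exp_real A.val continuous_subtype_val]
  exact hX

end Subalgebra

end MapExp

namespace Matrix

open NormedSpace
open scoped Matrix.Norms.Operator

variable {ι : Type*} [Fintype ι] [DecidableEq ι]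

theorem continuous_exp_real : Continuous (exp : Matrix ι ι ℝ → Matrix ι ι ℝ) :=
  letI := NormedAlgebra.restrictScalars ℚ ℝ (Matrix ι ι ℝ)
  exp_continuous

theorem commute_of_commute_exp {N X : Matrix ι ι ℝ} (hN : IsNilpotent N)
    (h : Commute (exp N) X) : Commute N X :=
  _root_.commute_of_commute_exp hN h

theorem exists_exp_eq_one_add_of_isNilpotent {A : Subalgebra ℝ (Matrix ι ι ℝ)}
    (hc : ∀ X ∈ A, ∀ Y ∈ A, Commute X Y) {N : Matrix ι ι ℝ} (hNA : N ∈ A) (hN : IsNilpotent N) :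
    ∃ Y ∈ A, exp Y = 1 + N :=
  Subalgebra.exists_exp_eq_one_add_of_isNilpotent hc hNA hN

theorem dense_setOf_exp_mem {A : Subalgebra ℝ (Matrix ι ι ℝ)}
    (hc : ∀ X ∈ A, ∀ Y ∈ A, Commute X Y) {U : Set (Matrix ι ι ℝ)}
    (hU : Dense {X : A | (X : Matrix ι ι ℝ) ∈ U}) : Dense {X : A | exp (X : Matrix ι ι ℝ) ∈ U} :=
  Subalgebra.dense_setOf_exp_mem hc hU

theorem map_exp_of_algHom {𝔸 : Type*} [NormedRing 𝔸] [NormedAlgebra ℝ 𝔸] [FiniteDimensional ℝ 𝔸]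
    (f : 𝔸 →ₐ[ℝ] Matrix ι ι ℝ) (x : 𝔸) : f (exp x) = exp (f x) :=
  have : CompleteSpace 𝔸 := FiniteDimensional.complete ℝ 𝔸
  map_exp_real f f.toLinearMap.continuous_of_finiteDimensional x

end Matrix

/-! ### Commuting sets with a dense orbit, and their centralizers. -/

section CyclicVector

open Matrix

variable {ι : Type*} [Fintype ι] {S : Set (Matrix ι ι ℝ)} {v : ι → ℝ}

/-- Evaluation of matrices at a vector. -/
def mulVecAt (v : ι → ℝ) : Matrix ι ι ℝ →ₗ[ℝ] (ι → ℝ) where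
  toFun A := A *ᵥ v
  map_add' A B := add_mulVec A B v
  map_smul' c A := smul_mulVec c A v

/-- The values of the span at `v` form a finite-dimensional, hence closed, subspace containing a
dense set. -/
theorem exists_mem_span_mulVec_eq (hd : Dense ((· *ᵥ v) '' S)) (x : ι → ℝ) :
    ∃ A ∈ Submodule.span ℝ S, A *ᵥ v = x := by
  have hcl : IsClosed (((Submodule.span ℝ S).map (mulVecAt v) : Submodule ℝ (ι → ℝ)) : Set (ι → ℝ)) :=
    Submodule.closed_of_finiteDimensional _
  have hle : closure ((· *ᵥ v) '' S) ⊆ ((Submodule.span ℝ S).map (mulVecAt v) : Set (ι → ℝ)) := by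
    refine closure_minimal ?_ hcl
    rintro _ ⟨A, hA, rfl⟩
    exact ⟨A, Submodule.subset_span hA, rfl⟩
  exact hle (hd x)

variable [DecidableEq ι]

theorem commute_of_mem_span_of_mem_centralizer {A X : Matrix ι ι ℝ} (hA : A ∈ Submodule.span ℝ S)
    (hX : X ∈ Subalgebra.centralizer ℝ S) : Commute A X := by
  induction hA using Submodule.span_induction with
  | mem A hA => exact Subalgebra.mem_centralizer_iff ℝ |>.1 hX A hA
  | zero => exact Commute.zero_left X
  | add A B _ _ hA hB => exact hA.add_left hB
  | smul c A _ hA => exact hA.smul_left c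

/-- Each basis vector is `A *ᵥ v` with `A` in the span, and `X`, `Y` can be moved past `A`. -/
theorem eq_of_mulVec_eq_of_mem_centralizer (hd : Dense ((· *ᵥ v) '' S)) {X Y : Matrix ι ι ℝ}
    (hX : X ∈ Subalgebra.centralizer ℝ S) (hY : Y ∈ Subalgebra.centralizer ℝ S)
    (h : X *ᵥ v = Y *ᵥ v) : X = Y := by
  refine Matrix.ext_of_mulVec_single fun i => ?_
  obtain ⟨A, hA, hAv⟩ := exists_mem_span_mulVec_eq hd (Pi.single i 1)
  rw [← hAv, mulVec_mulVec, mulVec_mulVec, ← (commute_of_mem_span_of_mem_centralizer hA hX).eq,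
    ← (commute_of_mem_span_of_mem_centralizer hA hY).eq, ← mulVec_mulVec, ← mulVec_mulVec, h]

theorem span_le_centralizer (hS : ∀ A ∈ S, ∀ B ∈ S, Commute A B) {A : Matrix ι ι ℝ}
    (hA : A ∈ Submodule.span ℝ S) : A ∈ Subalgebra.centralizer ℝ S := by
  rw [Subalgebra.mem_centralizer_iff]
  intro B hB
  exact (commute_of_mem_span_of_mem_centralizer hA
    ((Subalgebra.mem_centralizer_iff ℝ).2 fun C hC => hS C hC B hB)).eq.symm

theorem mem_span_of_mem_centralizer (hd : Dense ((· *ᵥ v) '' S))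
    (hS : ∀ A ∈ S, ∀ B ∈ S, Commute A B) {X : Matrix ι ι ℝ}
    (hX : X ∈ Subalgebra.centralizer ℝ S) : X ∈ Submodule.span ℝ S := by
  obtain ⟨A, hA, hAv⟩ := exists_mem_span_mulVec_eq hd (X *ᵥ v)
  rwa [← eq_of_mulVec_eq_of_mem_centralizer hd (span_le_centralizer hS hA) hX hAv]

theorem commute_of_mem_centralizer (hd : Dense ((· *ᵥ v) '' S))
    (hS : ∀ A ∈ S, ∀ B ∈ S, Commute A B) {X Y : Matrix ι ι ℝ}
    (hX : X ∈ Subalgebra.centralizer ℝ S) (hY : Y ∈ Subalgebra.centralizer ℝ S) : Commute X Y :=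
  commute_of_mem_span_of_mem_centralizer (mem_span_of_mem_centralizer hd hS hX) hY

/-- If a commuting set of matrices has a dense orbit at `v`, then evaluation at `v` identifies its
centralizer with the whole space. -/
noncomputable def centralizerEquiv (hd : Dense ((· *ᵥ v) '' S)) (hS : ∀ A ∈ S, ∀ B ∈ S, Commute A B) :
    Subalgebra.centralizer ℝ S ≃L[ℝ] (ι → ℝ) :=
  (LinearEquiv.ofBijective ((mulVecAt v).domRestrict (Subalgebra.centralizer ℝ S).toSubmodule)
    ⟨fun X Y h => Subtype.ext (eq_of_mulVec_eq_of_mem_centralizer hd X.2 Y.2 h), fun x => by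
      obtain ⟨A, hA, hAv⟩ := exists_mem_span_mulVec_eq hd x
      exact ⟨⟨A, span_le_centralizer hS hA⟩, hAv⟩⟩ :
    (Subalgebra.centralizer ℝ S).toSubmodule ≃ₗ[ℝ] (ι → ℝ)).toContinuousLinearEquiv

theorem centralizerEquiv_apply (hd : Dense ((· *ᵥ v) '' S))
    (hS : ∀ A ∈ S, ∀ B ∈ S, Commute A B) (X : Subalgebra.centralizer ℝ S) :
    centralizerEquiv hd hS X = (X : Matrix ι ι ℝ) *ᵥ v := rfl

theorem dense_centralizer_iff (hd : Dense ((· *ᵥ v) '' S)) (hS : ∀ A ∈ S, ∀ B ∈ S, Commute A B)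
    {U : Set (Matrix ι ι ℝ)} (hU : ∀ A ∈ U, A ∈ Subalgebra.centralizer ℝ S) :
    Dense {X : Subalgebra.centralizer ℝ S | (X : Matrix ι ι ℝ) ∈ U} ↔
      Dense ((· *ᵥ v) '' U) := by
  have himage : (· *ᵥ v) '' U = centralizerEquiv hd hS ''
      {X : Subalgebra.centralizer ℝ S | (X : Matrix ι ι ℝ) ∈ U} := by
    ext x
    constructor
    · rintro ⟨A, hA, rfl⟩
      exact ⟨⟨A, hU A hA⟩, hA, rfl⟩
    · rintro ⟨X, hX, rfl⟩
      exact ⟨X, hX, rfl⟩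
  rw [himage]
  refine ⟨fun h => (centralizerEquiv hd hS).surjective.denseRange.dense_image
    (centralizerEquiv hd hS).continuous h, fun h => ?_⟩
  rw [← Set.preimage_image_eq {X : Subalgebra.centralizer ℝ S | (X : Matrix ι ι ℝ) ∈ U}
    (centralizerEquiv hd hS).injective]
  exact h.preimage (centralizerEquiv hd hS).toHomeomorph.isOpenMap

end CyclicVector

/-! ### Density arguments in an algebra of central scalars plus nilpotents. -/

section ScalarSplitting

open Matrix NormedSpace Topology Filter

/-- The commutative algebra `ℝ^r × ℂ^s`. -/
abbrev RealCplx (r s : ℕ) : Type := (Fin r → ℝ) × (Fin s → ℂ)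

theorem RealCplx.isUnit_iff {r s : ℕ} {z : RealCplx r s} :
    IsUnit z ↔ (∀ k, z.1 k ≠ 0) ∧ ∀ l, z.2 l ≠ 0 := by
  simp [Prod.isUnit_iff, Pi.isUnit_iff]

theorem RealCplx.exists_exp_eq {r s : ℕ} {z : RealCplx r s} (h1 : ∀ k, 0 < z.1 k)
    (h2 : ∀ l, z.2 l ≠ 0) : ∃ w, exp w = z := by
  refine ⟨(fun k => Real.log (z.1 k), fun l => Complex.log (z.2 l)), ?_⟩
  refine Prod.ext (funext fun k => ?_) (funext fun l => ?_)
  · rw [Prod.fst_exp, Pi.coe_exp, ← Real.exp_eq_exp_ℝ, Real.exp_log (h1 k)]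
  · rw [Prod.snd_exp, Pi.coe_exp, ← Complex.exp_eq_exp_ℂ, Complex.exp_log (h2 l)]

/-- A subalgebra of matrices that is the sum of a central copy of `ℝ^r × ℂ^s` and a nilpotent part,
together with compatible `ℝ^r × ℂ^s`-valued coordinates on vectors. -/
structure ScalarSplitting (r s : ℕ) (ι : Type*) [Fintype ι] [DecidableEq ι] where
  alg : Subalgebra ℝ (Matrix ι ι ℝ)
  scalar : RealCplx r s →ₐ[ℝ] Matrix ι ι ℝ
  coord : (ι → ℝ) →ₗ[ℝ] RealCplx r s
  vec : ι → ℝ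
  scalar_mem : ∀ z, scalar z ∈ alg
  scalar_commute : ∀ z, ∀ X ∈ alg, Commute (scalar z) X
  coord_vec : coord vec = 1
  coord_scalar : ∀ z, coord (scalar z *ᵥ vec) = z
  coord_mulVec : ∀ X ∈ alg, ∀ v, coord (X *ᵥ v) = coord (X *ᵥ vec) * coord v
  isNilpotent_sub : ∀ X ∈ alg, IsNilpotent (X - scalar (coord (X *ᵥ vec)))

namespace ScalarSplitting

variable {r s : ℕ} {ι : Type*} [Fintype ι] [DecidableEq ι] (K : ScalarSplitting r s ι)

theorem continuous_coord : Continuous K.coord := K.coord.continuous_of_finiteDimensional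

theorem exp_scalar (z : RealCplx r s) : exp (K.scalar z) = K.scalar (exp z) :=
  (map_exp_of_algHom K.scalar z).symm

theorem coord_mul {X Y : Matrix ι ι ℝ} (hX : X ∈ K.alg) :
    K.coord ((X * Y) *ᵥ K.vec) = K.coord (X *ᵥ K.vec) * K.coord (Y *ᵥ K.vec) := by
  rw [← mulVec_mulVec, K.coord_mulVec X hX]

/-- Removing the central scalar part from `B` multiplies `exp B` by a factor commuting with `X`,
which reduces to the nilpotent case. -/
theorem commute_of_commute_exp {B X : Matrix ι ι ℝ} (hB : B ∈ K.alg) (hX : X ∈ K.alg)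
    (h : Commute (exp B) X) : Commute B X := by
  set z := K.coord (B *ᵥ K.vec)
  have hN := K.isNilpotent_sub B hB
  have hzB : Commute (K.scalar z) B := K.scalar_commute z B hB
  have hzX : Commute (K.scalar z) X := K.scalar_commute z X hX
  have h1 : exp (B - K.scalar z) = exp B * exp (-K.scalar z) := by
    rw [sub_eq_add_neg, Matrix.exp_add_of_commute _ _ hzB.neg_left.symm]
  have h2 : Commute (exp (B - K.scalar z)) X := by
    rw [h1]
    exact h.mul_left hzX.neg_left.exp_left
  have h3 := (Matrix.commute_of_commute_exp hN h2).add_left hzX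
  rwa [sub_add_cancel] at h3

theorem isUnit_of_isUnit_coord {X : Matrix ι ι ℝ} (hX : X ∈ K.alg)
    (h : IsUnit (K.coord (X *ᵥ K.vec))) : IsUnit X := by
  have hz : IsUnit (K.scalar (K.coord (X *ᵥ K.vec))) := h.map K.scalar
  have h1 := (K.isNilpotent_sub X hX).isUnit_add_left_of_commute hz
    ((K.scalar_commute _ X hX).symm.sub_left (Commute.refl _))
  rwa [add_sub_cancel] at h1

/-- A commutative algebra containing the scalars contains a logarithm of each of its elements
whose real coordinates are positive and whose complex coordinates do not vanish. -/
theorem exists_exp_eq {A : Subalgebra ℝ (Matrix ι ι ℝ)} (hA : A ≤ K.alg)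
    (hc : ∀ X ∈ A, ∀ Y ∈ A, Commute X Y) (hz : ∀ z, K.scalar z ∈ A) {X : Matrix ι ι ℝ} (hX : X ∈ A)
    (h1 : ∀ k, 0 < (K.coord (X *ᵥ K.vec)).1 k) (h2 : ∀ l, (K.coord (X *ᵥ K.vec)).2 l ≠ 0) :
    ∃ Y ∈ A, exp Y = X := by
  set z := K.coord (X *ᵥ K.vec)
  obtain ⟨w, hw⟩ := RealCplx.exists_exp_eq h1 h2
  -- Factor `X = z (1 + z⁻¹ (X - z))` with `z⁻¹ = exp (-w)`; the second factor is unipotent.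
  have hz' : exp (-w) * z = 1 := by
    rw [← hw, ← exp_add_of_commute_real (Commute.all _ _), neg_add_cancel, exp_zero]
  have hN : IsNilpotent (K.scalar (exp (-w)) * (X - K.scalar z)) :=
    ((K.scalar_commute _ _ (K.alg.sub_mem (hA hX) (K.scalar_mem z)))).isNilpotent_mul_left
      (K.isNilpotent_sub X (hA hX))
  have hNA : K.scalar (exp (-w)) * (X - K.scalar z) ∈ A :=
    A.mul_mem (hz _) (A.sub_mem hX (hz z))
  obtain ⟨Y, hY, hY'⟩ := exists_exp_eq_one_add_of_isNilpotent hc hNA hN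
  refine ⟨K.scalar w + Y, A.add_mem (hz w) hY, ?_⟩
  rw [Matrix.exp_add_of_commute _ _ (hc _ (hz w) _ hY), hY', K.exp_scalar, hw, mul_sub, ← map_mul, hz',
    map_one, add_sub_cancel, ← mul_assoc, ← map_mul, mul_comm z, hz', map_one, one_mul]

/-- The elements of the algebra whose exponential lies in `G`. -/
def logs (G : Subsemigroup (Matrix ι ι ℝ)) : Set (Matrix ι ι ℝ) := {B | exp B ∈ G ∧ B ∈ K.alg}

variable {K} {G : Subsemigroup (Matrix ι ι ℝ)}

theorem commute_of_mem_logs {B X : Matrix ι ι ℝ} (hG : ∀ A ∈ G, ∀ B ∈ G, Commute A B)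
    (hK : ∀ A ∈ G, A ∈ K.alg) (hB : B ∈ K.logs G) (hX : X ∈ G) : Commute B X :=
  K.commute_of_commute_exp hB.2 (hK X hX) (hG _ hB.1 X hX)

theorem logs_commute (hG : ∀ A ∈ G, ∀ B ∈ G, Commute A B) (hK : ∀ A ∈ G, A ∈ K.alg)
    {B C : Matrix ι ι ℝ} (hB : B ∈ K.logs G) (hC : C ∈ K.logs G) : Commute B C :=
  K.commute_of_commute_exp hB.2 hC.2 (commute_of_mem_logs hG hK hC hB.1).symm

theorem add_mem_logs (hG : ∀ A ∈ G, ∀ B ∈ G, Commute A B) (hK : ∀ A ∈ G, A ∈ K.alg)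
    {B C : Matrix ι ι ℝ} (hB : B ∈ K.logs G) (hC : C ∈ K.logs G) : B + C ∈ K.logs G := by
  refine ⟨?_, K.alg.add_mem hB.2 hC.2⟩
  rw [Matrix.exp_add_of_commute _ _ (logs_commute hG hK hB hC)]
  exact G.mul_mem hB.1 hC.1

/-- Take `A` in the span of `G` with `A *ᵥ v = K.vec`. It commutes with `G`, so it maps the orbit of
`v` onto that of `K.vec`; its coordinates have inverse `K.coord v`, so it is invertible. -/
theorem dense_orbit_vec_of_dense_orbit (hG : ∀ A ∈ G, ∀ B ∈ G, Commute A B)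
    (hK : ∀ A ∈ G, A ∈ K.alg) {v : ι → ℝ} (hv : Dense ((· *ᵥ v) '' (G : Set (Matrix ι ι ℝ)))) :
    Dense ((· *ᵥ K.vec) '' (G : Set (Matrix ι ι ℝ))) := by
  obtain ⟨A, hA, hAv⟩ := exists_mem_span_mulVec_eq hv K.vec
  have hle : Submodule.span ℝ (G : Set (Matrix ι ι ℝ)) ≤ K.alg.toSubmodule := Submodule.span_le.2 hK
  have hAK : A ∈ K.alg := hle hA
  have hunit : IsUnit A := by
    refine K.isUnit_of_isUnit_coord hAK (IsUnit.of_mul_eq_one (K.coord v) ?_)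
    rw [← K.coord_mulVec A hAK, hAv, K.coord_vec]
  have himage : (· *ᵥ K.vec) '' (G : Set (Matrix ι ι ℝ)) = (A *ᵥ ·) '' ((· *ᵥ v) '' G) := by
    rw [Set.image_image]
    refine Set.image_congr fun X hX => ?_
    have hc := commute_of_mem_span_of_mem_centralizer hA (span_le_centralizer hG
      (Submodule.subset_span hX))
    rw [mulVec_mulVec, hc.eq, ← mulVec_mulVec, hAv]
  rw [himage]
  refine DenseRange.dense_image (Function.Surjective.denseRange fun x => ?_) ?_ hv
  · obtain ⟨u, rfl⟩ := hunit
    exact ⟨(↑u⁻¹ : Matrix ι ι ℝ) *ᵥ x, by simp [mulVec_mulVec]⟩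
  · exact continuous_const.matrix_mulVec continuous_id

theorem dense_logs_of_dense_orbit (hG : ∀ A ∈ G, ∀ B ∈ G, Commute A B) (hK : ∀ A ∈ G, A ∈ K.alg)
    (hd : Dense ((· *ᵥ K.vec) '' (G : Set (Matrix ι ι ℝ)))) :
    Dense ((· *ᵥ K.vec) '' K.logs G) := by
  have hlogs : ∀ B ∈ K.logs G, B ∈ Subalgebra.centralizer ℝ (G : Set (Matrix ι ι ℝ)) := fun B hB =>
    (Subalgebra.mem_centralizer_iff ℝ).2 fun X hX => (commute_of_mem_logs hG hK hB hX).eq.symm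
  rw [← dense_centralizer_iff hd hG hlogs]
  set A := Subalgebra.centralizer ℝ (G : Set (Matrix ι ι ℝ))
  have hA : ∀ X ∈ A, X ∈ K.alg := fun X hX =>
    (Submodule.span_le.2 hK : _ ≤ K.alg.toSubmodule) (mem_span_of_mem_centralizer hd hG hX)
  have hGA : Dense {X : A | (X : Matrix ι ι ℝ) ∈ (G : Set (Matrix ι ι ℝ))} :=
    (dense_centralizer_iff hd hG fun X hX => span_le_centralizer hG (Submodule.subset_span hX)).2 hd
  exact (dense_setOf_exp_mem (fun X hX Y hY => commute_of_mem_centralizer hd hG hX hY) hGA).mono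
    fun X hX => ⟨hX, hA X X.2⟩

/-- The sign pattern is an open condition on the orbit point, met by the scalar with `-1` in place
`k` and `1` elsewhere. Nonzero complex coordinates are imposed as well to make the matrix
invertible. -/
theorem exists_sign_of_dense_orbit (hK : ∀ A ∈ G, A ∈ K.alg)
    (hd : Dense ((· *ᵥ K.vec) '' (G : Set (Matrix ι ι ℝ)))) (k : Fin r) :
    ∃ A ∈ G, IsUnit A ∧ (K.coord (A *ᵥ K.vec)).1 k < 0 ∧
      ∀ i, i ≠ k → 0 < (K.coord (A *ᵥ K.vec)).1 i := by
  set w : RealCplx r s := (Function.update 1 k (-1), 1)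
  have hev : ∀ᶠ x in 𝓝 (K.scalar w *ᵥ K.vec), (K.coord x).1 k < 0 ∧
      (∀ i, i ≠ k → 0 < (K.coord x).1 i) ∧ ∀ l, (K.coord x).2 l ≠ 0 := by
    have h1 (i : Fin r) : Continuous fun x => (K.coord x).1 i :=
      (continuous_apply i).comp (continuous_fst.comp K.continuous_coord)
    have h2 (l : Fin s) : Continuous fun x => (K.coord x).2 l :=
      (continuous_apply l).comp (continuous_snd.comp K.continuous_coord)
    refine ((h1 k).continuousAt.eventually_lt_const ?_).and
      ((eventually_all.2 fun i => eventually_imp_distrib_left.2 fun hi =>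
        (h1 i).continuousAt.eventually_const_lt ?_).and
      (eventually_all.2 fun l => (h2 l).continuousAt.eventually_ne ?_))
    · simp [K.coord_scalar, w]
    · simp [K.coord_scalar, w, hi]
    · simp [K.coord_scalar, w]
  obtain ⟨x, ⟨A, hA, rfl⟩, h1, h2, h3⟩ := hd.inter_nhds_nonempty hev
  refine ⟨A, hA, K.isUnit_of_isUnit_coord (hK A hA) (RealCplx.isUnit_iff.2 ⟨fun i => ?_, h3⟩), h1, h2⟩
  by_cases hi : i = k
  · rw [hi]
    exact h1.ne
  · exact (h2 i hi).ne'

/-- Here `t` is the set of negative real coordinates. For `t` empty, `X` is an exponential from `A`,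
approximated through `hd`. Otherwise divide by the element of `G` that is negative exactly at `k`:
this removes `k` from `t`, and multiplying back preserves the closure of `G`. -/
theorem mem_closure_of_sign {A : Subalgebra ℝ (Matrix ι ι ℝ)} (hA : A ≤ K.alg)
    (hc : ∀ X ∈ A, ∀ Y ∈ A, Commute X Y) (hz : ∀ z, K.scalar z ∈ A)
    (hinv : ∀ u : (Matrix ι ι ℝ)ˣ, (u : Matrix ι ι ℝ) ∈ A → (↑u⁻¹ : Matrix ι ι ℝ) ∈ A)
    (hGA : ∀ X ∈ G, X ∈ A) (hd : Dense {X : A | exp (X : Matrix ι ι ℝ) ∈ G})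
    (hsign : ∀ k, ∃ X ∈ G, IsUnit X ∧ (K.coord (X *ᵥ K.vec)).1 k < 0 ∧
      ∀ i, i ≠ k → 0 < (K.coord (X *ᵥ K.vec)).1 i) (t : Finset (Fin r)) :
    ∀ X ∈ A, (∀ k ∈ t, (K.coord (X *ᵥ K.vec)).1 k < 0) →
      (∀ k ∉ t, 0 < (K.coord (X *ᵥ K.vec)).1 k) → (∀ l, (K.coord (X *ᵥ K.vec)).2 l ≠ 0) →
      X ∈ closure (G : Set (Matrix ι ι ℝ)) := by
  induction t using Finset.induction_on with
  | empty =>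
    intro X hX _ h1 h2
    obtain ⟨Y, hY, rfl⟩ := K.exists_exp_eq hA hc hz hX (fun k => h1 k (Finset.notMem_empty k)) h2
    exact map_mem_closure (f := fun Y : A => exp (Y : Matrix ι ι ℝ))
      (t := (G : Set (Matrix ι ι ℝ)))
      (continuous_exp_real.comp continuous_subtype_val) (hd ⟨Y, hY⟩) (fun Y hY => hY)
  | insert k t hk ih =>
    intro X hX h1 h2 h3
    obtain ⟨_, hg, ⟨u, rfl⟩, hk1, hk2⟩ := hsign k
    have hY : (↑u⁻¹ : Matrix ι ι ℝ) * X ∈ A := A.mul_mem (hinv u (hGA _ hg)) hX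
    have hXY : X = u * ((↑u⁻¹ : Matrix ι ι ℝ) * X) := (Units.mul_inv_cancel_left u X).symm
    generalize (↑u⁻¹ : Matrix ι ι ℝ) * X = Y at hY hXY
    subst hXY
    simp only [K.coord_mul (hA (hGA _ hg)), Prod.fst_mul, Prod.snd_mul, Pi.mul_apply] at h1 h2 h3
    refine map_mem_closure (f := fun Y => (u : Matrix ι ι ℝ) * Y) (continuous_const_mul _)
      (ih Y hY (fun i hi => ?_) (fun i hi => ?_) fun l => right_ne_zero_of_mul (h3 l))
      (fun Z hZ => G.mul_mem hg hZ)
    · have hik : i ≠ k := fun h => hk (h ▸ hi)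
      exact neg_of_mul_neg_right (h1 i (Finset.mem_insert_of_mem hi)) (hk2 i hik).le
    · by_cases hik : i = k
      · subst hik
        exact pos_of_mul_neg_right (h1 i (Finset.mem_insert_self i t)) hk1.le
      · exact pos_of_mul_pos_right (h2 i (by simp [hik, hi])) (hk2 i hik).le

/-- The ambient commutative algebra is now the centralizer of the logarithms, whose density is the
hypothesis; it contains `G` and the scalars. -/
theorem dense_orbit_of_dense_logs (hG : ∀ A ∈ G, ∀ B ∈ G, Commute A B) (hK : ∀ A ∈ G, A ∈ K.alg)
    (hd : Dense ((· *ᵥ K.vec) '' K.logs G))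
    (hsign : ∀ k, ∃ X ∈ G, IsUnit X ∧ (K.coord (X *ᵥ K.vec)).1 k < 0 ∧
      ∀ i, i ≠ k → 0 < (K.coord (X *ᵥ K.vec)).1 i) :
    Dense ((· *ᵥ K.vec) '' (G : Set (Matrix ι ι ℝ))) := by
  have hg : ∀ B ∈ K.logs G, ∀ C ∈ K.logs G, Commute B C := fun B hB C hC => logs_commute hG hK hB hC
  have hA : Subalgebra.centralizer ℝ (K.logs G) ≤ K.alg := fun X hX =>
    (Submodule.span_le.2 fun B hB => hB.2 : _ ≤ K.alg.toSubmodule)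
      (mem_span_of_mem_centralizer hd hg hX)
  have hcl := mem_closure_of_sign (G := G) hA
    (fun X hX Y hY => commute_of_mem_centralizer hd hg hX hY)
    (fun z => (Subalgebra.mem_centralizer_iff ℝ).2 fun B hB => (K.scalar_commute z B hB.2).eq.symm)
    (fun u hu => (Subalgebra.mem_centralizer_iff ℝ).2 fun B hB =>
      (Commute.units_inv_right ((Subalgebra.mem_centralizer_iff ℝ).1 hu B hB)).eq)
    (fun X hX => (Subalgebra.mem_centralizer_iff ℝ).2 fun B hB =>
      (commute_of_mem_logs hG hK hB hX).eq)
    (((dense_centralizer_iff hd hg fun B hB => span_le_centralizer hg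
      (Submodule.subset_span hB)).2 hd).mono fun X hX => hX.1) hsign
  intro x
  obtain ⟨X, rfl⟩ := (centralizerEquiv hd hg).surjective x
  rw [centralizerEquiv_apply]
  refine map_mem_closure (f := (· *ᵥ K.vec)) (continuous_id.matrix_mulVec continuous_const) ?_
    (fun Y hY => Set.mem_image_of_mem _ hY)
  -- Coordinates of `X` may vanish; those of `X + t • 1` do not for small `t ≠ 0`.
  have hlim : Tendsto (fun t : ℝ => (X : Matrix ι ι ℝ) + t • (1 : Matrix ι ι ℝ)) (𝓝[≠] 0)
      (𝓝 (X : Matrix ι ι ℝ)) := by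
    have : Continuous fun t : ℝ => (X : Matrix ι ι ℝ) + t • (1 : Matrix ι ι ℝ) := by fun_prop
    simpa using (this.tendsto 0).mono_left nhdsWithin_le_nhds
  rw [← closure_closure]
  refine mem_closure_of_tendsto hlim ?_
  have hne {E : Type} [NormedRing E] [NormedAlgebra ℝ E] [Nontrivial E] (p : E) :
      ∀ᶠ t : ℝ in 𝓝[≠] 0, p + algebraMap ℝ E t ≠ 0 := by
    by_cases hp : p = 0
    · filter_upwards [self_mem_nhdsWithin] with t ht
      simpa [hp] using ht
    · have : Continuous fun t : ℝ => p + algebraMap ℝ E t := by fun_prop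
      exact (this.continuousAt.eventually_ne (by simpa using hp)).filter_mono nhdsWithin_le_nhds
  filter_upwards [eventually_all.2 fun k => hne ((K.coord ((X : Matrix ι ι ℝ) *ᵥ K.vec)).1 k),
    eventually_all.2 fun l => hne ((K.coord ((X : Matrix ι ι ℝ) *ᵥ K.vec)).2 l)] with t h1 h2
  have hcoord : K.coord (((X : Matrix ι ι ℝ) + t • (1 : Matrix ι ι ℝ)) *ᵥ K.vec) =
      K.coord ((X : Matrix ι ι ℝ) *ᵥ K.vec) + t • 1 := by
    rw [add_mulVec, smul_mulVec, one_mulVec, map_add, map_smul, K.coord_vec]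
  refine hcl (Finset.univ.filter fun k => (K.coord (((X : Matrix ι ι ℝ) +
    t • (1 : Matrix ι ι ℝ)) *ᵥ K.vec)).1 k < 0) _ (Subalgebra.add_mem _ X.2
      (Subalgebra.smul_mem _ (Subalgebra.one_mem _) t)) (fun k hk => ?_) (fun k hk => ?_) fun l => ?_
  · simpa using hk
  · refine lt_of_le_of_ne (by simpa using hk) ?_
    rw [hcoord]
    simpa using (h1 k).symm
  · rw [hcoord]
    simpa using h2 l

end ScalarSplitting

end ScalarSplitting

/-! ### Triangular matrices with constant diagonal. -/

section Triangular

open Matrix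

/-- Each power pushes the support one diagonal lower. The ring need not be commutative, so `2 × 2`
blocks can serve as entries. -/
theorem isNilpotent_of_strictly_lower {Q : Type*} [Ring Q] {m : ℕ} {N : Matrix (Fin m) (Fin m) Q}
    (hN : ∀ i j, i ≤ j → N i j = 0) : N ^ m = 0 := by
  have h (p : ℕ) : ∀ i j : Fin m, (i : ℕ) < j + p → (N ^ p) i j = 0 := by
    induction p with
    | zero =>
      intro i j hij
      rw [pow_zero, one_apply_ne]
      rintro rfl
      omega
    | succ p ih =>
      intro i j hij
      rw [pow_succ, mul_apply]
      refine Finset.sum_eq_zero fun k _ => ?_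
      by_cases hk : (i : ℕ) < k + p
      · rw [ih i k hk, zero_mul]
      · rw [hN k j (Fin.le_def.2 (by omega)), mul_zero]
  ext i j
  exact h m i j (by omega)

/-- Lower triangular matrices with entries in a subalgebra and constant diagonal. -/
def triangularSubalgebra {Q : Type*} [Ring Q] [Algebra ℝ Q] (S : Subalgebra ℝ Q) (m : ℕ) :
    Subalgebra ℝ (Matrix (Fin m) (Fin m) Q) where
  carrier := {M | (∀ i j, M i j ∈ S) ∧ (∀ i j, i < j → M i j = 0) ∧ ∀ i j, M i i = M j j}
  mul_mem' := by
    rintro M N ⟨h1, h2, h3⟩ ⟨h1', h2', h3'⟩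
    have hdiag (i : Fin m) : (M * N) i i = M i i * N i i := by
      rw [mul_apply]
      refine Finset.sum_eq_single i (fun k _ hk => ?_) (by simp)
      rcases lt_or_gt_of_ne hk with h | h
      · rw [h2' k i h, mul_zero]
      · rw [h2 i k h, zero_mul]
    refine ⟨fun i j => ?_, fun i j hij => ?_, fun i j => ?_⟩
    · rw [mul_apply]
      exact S.sum_mem fun k _ => S.mul_mem (h1 i k) (h1' k j)
    · rw [mul_apply]
      refine Finset.sum_eq_zero fun k _ => ?_
      rcases lt_or_ge i k with h | h
      · rw [h2 i k h, zero_mul]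
      · rw [h2' k j (h.trans_lt hij), mul_zero]
    · rw [hdiag, hdiag, h3 i j, h3' i j]
  add_mem' := by
    rintro M N ⟨h1, h2, h3⟩ ⟨h1', h2', h3'⟩
    refine ⟨fun i j => S.add_mem (h1 i j) (h1' i j), fun i j hij => ?_, fun i j => ?_⟩
    · rw [Matrix.add_apply, h2 i j hij, h2' i j hij, add_zero]
    · rw [Matrix.add_apply, Matrix.add_apply, h3 i j, h3' i j]
  algebraMap_mem' c := by
    refine ⟨fun i j => ?_, fun i j hij => ?_, fun i j => ?_⟩
    · rw [algebraMap_matrix_apply]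
      split_ifs
      · exact S.algebraMap_mem c
      · exact S.zero_mem
    · rw [algebraMap_matrix_apply, if_neg hij.ne]
    · simp [algebraMap_matrix_apply]

theorem mem_triangularSubalgebra {Q : Type*} [Ring Q] [Algebra ℝ Q] {S : Subalgebra ℝ Q} {m : ℕ}
    {M : Matrix (Fin m) (Fin m) Q} : M ∈ triangularSubalgebra S m ↔
      (∀ i j, M i j ∈ S) ∧ (∀ i j, i < j → M i j = 0) ∧ ∀ i j, M i i = M j j :=
  Iff.rfl

theorem scalar_mem_triangularSubalgebra {Q : Type*} [Ring Q] [Algebra ℝ Q] {S : Subalgebra ℝ Q}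
    {m : ℕ} {c : Q} (hc : c ∈ S) : scalar (Fin m) c ∈ triangularSubalgebra S m := by
  refine ⟨fun i j => ?_, fun i j hij => ?_, fun i j => ?_⟩
  · rw [scalar_apply, diagonal_apply]
    split_ifs
    · exact hc
    · exact S.zero_mem
  · rw [scalar_apply, diagonal_apply_ne _ hij.ne]
  · simp

theorem sub_scalar_pow_eq_zero {Q : Type*} [Ring Q] [Algebra ℝ Q] {S : Subalgebra ℝ Q} {m : ℕ}
    {M : Matrix (Fin m) (Fin m) Q} (hM : M ∈ triangularSubalgebra S m) (i : Fin m) :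
    (M - scalar (Fin m) (M i i)) ^ m = 0 := by
  refine isNilpotent_of_strictly_lower fun j k hjk => ?_
  rcases hjk.eq_or_lt with rfl | h
  · simp [hM.2.2 j i]
  · simp [hM.2.1 j k h, diagonal_apply_ne _ h.ne]

/-- The complex numbers as real matrices of order two. -/
noncomputable def cplxHom : ℂ →ₐ[ℝ] Matrix (Fin 2) (Fin 2) ℝ :=
  Algebra.leftMulMatrix Complex.basisOneI

theorem cplxHom_apply (z : ℂ) : cplxHom z = !![z.re, -z.im; z.im, z.re] :=
  Algebra.leftMulMatrix_complex z

end Triangular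

/-! ### The normal form as an algebra of triangular blocks. -/

namespace HypercyclicNormalForm

open Matrix

theorem mem_cplxMat_iff {C : Matrix (Fin 2) (Fin 2) ℝ} : C ∈ cplxMat ↔ C ∈ cplxHom.range := by
  constructor
  · rintro ⟨α, β, rfl⟩
    -- `cplxHom` puts `-im` in the upper right corner, hence the sign.
    exact ⟨⟨α, -β⟩, by simp [cplxHom_apply]⟩
  · rintro ⟨z, rfl⟩
    exact ⟨z.re, -z.im, by simp [cplxHom_apply]⟩

theorem mem_lowerTri_iff {m : ℕ} {M : Matrix (Fin m) (Fin m) ℝ} :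
    M ∈ lowerTri m ↔ M ∈ triangularSubalgebra (⊤ : Subalgebra ℝ ℝ) m := by
  simp [lowerTri, mem_triangularSubalgebra]

theorem comp_mem_lowerTriCplx_iff {m : ℕ} {M : Matrix (Fin m) (Fin m) (Matrix (Fin 2) (Fin 2) ℝ)} :
    comp _ _ _ _ _ M ∈ lowerTriCplx m ↔ M ∈ triangularSubalgebra cplxHom.range m := by
  have h (i j : Fin m) : subBlock (comp _ _ _ _ _ M) i j = M i j := rfl
  simp only [lowerTriCplx, mem_triangularSubalgebra, Set.mem_ofPred_eq, h, mem_cplxMat_iff]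

namespace BlockSizes

variable {n r s : ℕ} (η : BlockSizes n r s)

/-- Families of square blocks with the sizes of `η`. -/
abbrev Blocks : Type :=
  (∀ k, Matrix (Fin (η.realSize k)) (Fin (η.realSize k)) ℝ) ×
    (∀ l, Matrix (Fin (η.cplxSize l)) (Fin (η.cplxSize l)) (Matrix (Fin 2) (Fin 2) ℝ))

/-- The block diagonal matrix with given blocks. -/
noncomputable def ofBlocks : η.Blocks →ₐ[ℝ] Matrix (Fin n) (Fin n) ℝ :=
  (reindexAlgEquiv ℝ ℝ η.indexEquiv).toAlgHom.comp <| AlgHom.ofLinearMap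
    { toFun := fun a => fromBlocks (blockDiagonal' a.1) 0 0
        (blockDiagonal' fun l => comp _ _ _ _ _ (a.2 l))
      map_add' := fun a b => by
        rw [fromBlocks_add, add_zero, add_zero, ← blockDiagonal'_add, ← blockDiagonal'_add]
        rfl
      map_smul' := fun c a => by
        rw [RingHom.id_apply, fromBlocks_smul, smul_zero, smul_zero, ← blockDiagonal'_smul,
          ← blockDiagonal'_smul]
        rfl }
    (by
      show fromBlocks (blockDiagonal' 1) 0 0 (blockDiagonal' fun l =>
        compAlgEquiv (Fin (η.cplxSize l)) (Fin 2) ℝ ℝ 1) = 1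
      simp_rw [map_one]
      rw [blockDiagonal'_one, ← Pi.one_def, blockDiagonal'_one, fromBlocks_one])
    (fun a b => by
      show fromBlocks (blockDiagonal' fun k => a.1 k * b.1 k) 0 0 (blockDiagonal' fun l =>
        compAlgEquiv (Fin (η.cplxSize l)) (Fin 2) ℝ ℝ (a.2 l * b.2 l)) = fromBlocks _ _ _ _ *
        fromBlocks _ _ _ _
      simp_rw [map_mul]
      rw [blockDiagonal'_mul, blockDiagonal'_mul, fromBlocks_multiply]
      simp)

theorem ofBlocks_apply (a : η.Blocks) : η.ofBlocks a = reindex η.indexEquiv η.indexEquiv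
    (fromBlocks (blockDiagonal' a.1) 0 0 (blockDiagonal' fun l => comp _ _ _ _ _ (a.2 l))) := rfl

/-- The families of triangular blocks. -/
noncomputable def triangularBlocks : Subalgebra ℝ η.Blocks :=
  (Subalgebra.pi Set.univ fun k => triangularSubalgebra ⊤ (η.realSize k)).prod
    (Subalgebra.pi Set.univ fun l => triangularSubalgebra cplxHom.range (η.cplxSize l))

theorem mem_triangularBlocks {a : η.Blocks} : a ∈ η.triangularBlocks ↔
    (∀ k, a.1 k ∈ triangularSubalgebra ⊤ (η.realSize k)) ∧
      ∀ l, a.2 l ∈ triangularSubalgebra cplxHom.range (η.cplxSize l) := by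
  simp [triangularBlocks, Subalgebra.mem_prod, Subalgebra.mem_pi]

theorem mem_normalForm_iff {M : Matrix (Fin n) (Fin n) ℝ} :
    M ∈ η.normalForm ↔ ∃ a ∈ η.triangularBlocks, η.ofBlocks a = M := by
  constructor
  · rintro ⟨T, B, hT, hB, rfl⟩
    refine ⟨(T, fun l => (comp _ _ _ _ _).symm (B l)), η.mem_triangularBlocks.2
      ⟨fun k => mem_lowerTri_iff.1 (hT k), fun l => comp_mem_lowerTriCplx_iff.1 ?_⟩, ?_⟩
    · simpa using hB l
    · simp [ofBlocks_apply]
  · rintro ⟨a, ha, rfl⟩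
    rw [mem_triangularBlocks] at ha
    exact ⟨a.1, _, fun k => mem_lowerTri_iff.2 (ha.1 k),
      fun l => comp_mem_lowerTriCplx_iff.2 (ha.2 l), rfl⟩

theorem realBlock_ofBlocks (a : η.Blocks) (k : Fin r) : η.realBlock (η.ofBlocks a) k = a.1 k := by
  ext i j
  simp [realBlock, ofBlocks_apply]

/-- The first place of a real block. -/
def realFst (k : Fin r) : Fin (η.realSize k) := ⟨0, η.realSize_pos k⟩

/-- The first place of a complex block. -/
def cplxFst (l : Fin s) : Fin (η.cplxSize l) := ⟨0, η.cplxSize_pos l⟩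

/-- The families of scalar blocks. -/
noncomputable def scalarBlocks : RealCplx r s →ₐ[ℝ] η.Blocks :=
  AlgHom.prod
    (AlgHom.pi fun k => (scalarAlgHom (Fin (η.realSize k)) ℝ).comp
      ((Pi.evalAlgHom ℝ _ k).comp (AlgHom.fst ℝ _ _)))
    (AlgHom.pi fun l => (scalarAlgHom (Fin (η.cplxSize l)) ℝ).comp
      (cplxHom.comp ((Pi.evalAlgHom ℝ _ l).comp (AlgHom.snd ℝ _ _))))

theorem scalarBlocks_fst (z : RealCplx r s) (k : Fin r) :
    (η.scalarBlocks z).1 k = scalar _ (z.1 k) := rfl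

theorem scalarBlocks_snd (z : RealCplx r s) (l : Fin s) :
    (η.scalarBlocks z).2 l = scalar _ (cplxHom (z.2 l)) := rfl

/-- The diagonal entries of a family of triangular blocks. -/
def diagEntries (a : η.Blocks) : RealCplx r s :=
  (fun k => a.1 k (η.realFst k) (η.realFst k),
    fun l => ⟨a.2 l (η.cplxFst l) (η.cplxFst l) 0 0, a.2 l (η.cplxFst l) (η.cplxFst l) 1 0⟩)

/-- A matrix in the range of `cplxHom` is determined by its first column, the part that
`diagEntries` reads. -/
theorem cplxHom_diagEntries {a : η.Blocks} (ha : a ∈ η.triangularBlocks) (l : Fin s) :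
    cplxHom ((η.diagEntries a).2 l) = a.2 l (η.cplxFst l) (η.cplxFst l) := by
  obtain ⟨w, hw⟩ := ((η.mem_triangularBlocks.1 ha).2 l).1 (η.cplxFst l) (η.cplxFst l)
  have hw' : cplxHom w = a.2 l (η.cplxFst l) (η.cplxFst l) := hw
  have hd : (η.diagEntries a).2 l = w := by
    apply Complex.ext
    · show a.2 l (η.cplxFst l) (η.cplxFst l) 0 0 = w.re
      rw [← hw', cplxHom_apply]
      rfl
    · show a.2 l (η.cplxFst l) (η.cplxFst l) 1 0 = w.im
      rw [← hw', cplxHom_apply]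
      rfl
  rw [hd, hw']

theorem diagEntries_scalarBlocks (z : RealCplx r s) : η.diagEntries (η.scalarBlocks z) = z := by
  refine Prod.ext (funext fun k => ?_) (funext fun l => ?_)
  · simp [diagEntries, scalarBlocks_fst]
  · simp [diagEntries, scalarBlocks_snd, cplxHom_apply]

theorem scalarBlocks_mem (z : RealCplx r s) : η.scalarBlocks z ∈ η.triangularBlocks :=
  η.mem_triangularBlocks.2 ⟨fun _ => scalar_mem_triangularSubalgebra trivial,
    fun _ => scalar_mem_triangularSubalgebra ⟨_, rfl⟩⟩

theorem scalarBlocks_commute (z : RealCplx r s) {a : η.Blocks} (ha : a ∈ η.triangularBlocks) :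
    Commute (η.scalarBlocks z) a := by
  rw [mem_triangularBlocks] at ha
  refine Prod.ext (funext fun k => ?_) (funext fun l => ?_)
  · exact scalar_commute _ (fun c => Commute.all _ c) _
  · ext1 i j
    obtain ⟨w, hw⟩ := (ha.2 l).1 i j
    show (scalar (Fin (η.cplxSize l)) (cplxHom (z.2 l)) * a.2 l) i j =
      (a.2 l * scalar (Fin (η.cplxSize l)) (cplxHom (z.2 l))) i j
    rw [scalar_apply, diagonal_mul, mul_diagonal, ← hw]
    exact ((Commute.all (z.2 l) w).map cplxHom).eq

theorem isNilpotent_sub_scalarBlocks {a : η.Blocks} (ha : a ∈ η.triangularBlocks) :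
    IsNilpotent (a - η.scalarBlocks (η.diagEntries a)) := by
  have ha' := η.mem_triangularBlocks.1 ha
  -- No block is larger than `n`, so one exponent serves all of them.
  refine ⟨n, Prod.ext (funext fun k => ?_) (funext fun l => ?_)⟩
  · refine pow_eq_zero_of_le ?_ (sub_scalar_pow_eq_zero (ha'.1 k) (η.realFst k))
    have := Finset.single_le_sum (f := η.realSize) (fun i _ => Nat.zero_le _) (Finset.mem_univ k)
    have := η.sum_eq
    omega
  · show (a.2 l - scalar _ (cplxHom ((η.diagEntries a).2 l))) ^ n = 0
    rw [η.cplxHom_diagEntries ha]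
    refine pow_eq_zero_of_le ?_ (sub_scalar_pow_eq_zero (ha'.2 l) (η.cplxFst l))
    have := Finset.single_le_sum (f := η.cplxSize) (fun i _ => Nat.zero_le _) (Finset.mem_univ l)
    have := η.sum_eq
    omega

/-- The first coordinates of a vector in all blocks. -/
def fstCoords : (Fin n → ℝ) →ₗ[ℝ] RealCplx r s where
  toFun x := (fun k => x (η.indexEquiv (Sum.inl ⟨k, η.realFst k⟩)), fun l =>
    ⟨x (η.indexEquiv (Sum.inr ⟨l, η.cplxFst l, 0⟩)),
      x (η.indexEquiv (Sum.inr ⟨l, η.cplxFst l, 1⟩))⟩)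
  map_add' x y := rfl
  map_smul' c x := by
    refine Prod.ext rfl (funext fun l => ?_)
    apply Complex.ext <;> simp

theorem fstCoords_u₀ : η.fstCoords η.u₀ = 1 := by
  refine Prod.ext (funext fun k => ?_) (funext fun l => ?_)
  · simp [fstCoords, u₀, realFst]
  · apply Complex.ext <;> simp [fstCoords, u₀, cplxFst]

/-- In the first row of a lower triangular block only the diagonal entry survives. -/
theorem fstCoords_mulVec {a : η.Blocks} (ha : a ∈ η.triangularBlocks) (x : Fin n → ℝ) :
    η.fstCoords (η.ofBlocks a *ᵥ x) = η.diagEntries a * η.fstCoords x := by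
  obtain ⟨hT, hB⟩ := η.mem_triangularBlocks.1 ha
  have hsum (i : η.Index) : (η.ofBlocks a *ᵥ x) (η.indexEquiv i) =
      ∑ j, fromBlocks (blockDiagonal' a.1) 0 0 (blockDiagonal' fun l => comp _ _ _ _ _ (a.2 l)) i j *
        x (η.indexEquiv j) := by
    rw [mulVec, dotProduct, ← η.indexEquiv.sum_comp]
    simp [ofBlocks_apply]
  refine Prod.ext (funext fun k => ?_) (funext fun l => ?_)
  · show (η.ofBlocks a *ᵥ x) (η.indexEquiv _) = _
    rw [hsum, Finset.sum_eq_single (Sum.inl ⟨k, η.realFst k⟩)]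
    · simp [diagEntries, fstCoords]
    · rintro (⟨k', j⟩ | j) - hj
      · by_cases hk : k = k'
        · subst hk
          have hj' : η.realFst k < j := Fin.lt_def.2 (Nat.pos_of_ne_zero fun h => hj (by
            rw [show j = η.realFst k from Fin.ext h]))
          simp [(hT k).2.1 _ _ hj']
        · simp [blockDiagonal'_apply_ne _ _ _ hk]
      · simp
    · simp
  · have hrow (b : Fin 2) : (η.ofBlocks a *ᵥ x) (η.indexEquiv (Sum.inr ⟨l, η.cplxFst l, b⟩)) =
        ∑ c, a.2 l (η.cplxFst l) (η.cplxFst l) b c *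
          x (η.indexEquiv (Sum.inr ⟨l, η.cplxFst l, c⟩)) := by
      rw [hsum, Fintype.sum_sum_type, Fintype.sum_sigma, Fintype.sum_sigma]
      simp only [fromBlocks_apply₂₁, fromBlocks_apply₂₂, Matrix.zero_apply, zero_mul,
        Finset.sum_const_zero, zero_add]
      rw [Finset.sum_eq_single l, Fintype.sum_prod_type, Finset.sum_eq_single (η.cplxFst l)]
      · simp
      · intro j _ hj
        have hj' : η.cplxFst l < j := Fin.lt_def.2 (Nat.pos_of_ne_zero fun h => hj (Fin.ext h))
        simp [(hB l).2.1 _ _ hj']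
      · simp
      · intro l' _ hl
        exact Finset.sum_eq_zero fun j _ => by
          rw [blockDiagonal'_apply_ne _ _ _ hl.symm, zero_mul]
      · simp
    rw [← η.cplxHom_diagEntries ha, cplxHom_apply] at hrow
    rw [Prod.snd_mul, Pi.mul_apply]
    apply Complex.ext
    · show (η.ofBlocks a *ᵥ x) (η.indexEquiv _) = _
      rw [hrow]
      simp [fstCoords]
      ring
    · show (η.ofBlocks a *ᵥ x) (η.indexEquiv _) = _
      rw [hrow]
      simp [fstCoords]
      ring

end BlockSizes

end HypercyclicNormalForm

/-! ### Conjugation by `P`, eigenvalues and the index. -/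

namespace HypercyclicNormalForm

open Matrix

namespace BlockSizes

variable {n r s : ℕ} (η : BlockSizes n r s) (P : GL (Fin n) ℝ)

/-- The block diagonal matrix with given blocks, conjugated by `P`. -/
noncomputable def ofBlocksConj : η.Blocks →ₐ[ℝ] Matrix (Fin n) (Fin n) ℝ :=
  AlgHom.ofLinearMap
    ((LinearMap.mulRight ℝ ((P⁻¹ : GL (Fin n) ℝ) : Matrix (Fin n) (Fin n) ℝ)).comp
      ((LinearMap.mulLeft ℝ (P : Matrix (Fin n) (Fin n) ℝ)).comp η.ofBlocks.toLinearMap))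
    (by simp)
    (fun a b => by
      simp only [LinearMap.comp_apply, LinearMap.mulLeft_apply, LinearMap.mulRight_apply,
        AlgHom.toLinearMap_apply, map_mul, mul_assoc, Units.inv_mul_cancel_left])

theorem ofBlocksConj_apply (a : η.Blocks) : η.ofBlocksConj P a =
    (P : Matrix (Fin n) (Fin n) ℝ) * η.ofBlocks a * ((P⁻¹ : GL (Fin n) ℝ) : Matrix _ _ ℝ) := rfl

/-- The first coordinates of a vector in all blocks, with respect to the basis given by `P`. -/
noncomputable def fstCoordsConj : (Fin n → ℝ) →ₗ[ℝ] RealCplx r s :=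
  η.fstCoords.comp (mulVecLin ((P⁻¹ : GL (Fin n) ℝ) : Matrix (Fin n) (Fin n) ℝ))

theorem fstCoordsConj_v₀ : η.fstCoordsConj P (η.v₀ P) = 1 := by
  rw [fstCoordsConj, LinearMap.comp_apply, mulVecLin_apply, v₀, mulVec_mulVec, Units.inv_mul,
    one_mulVec, fstCoords_u₀]

theorem fstCoordsConj_mulVec {a : η.Blocks} (ha : a ∈ η.triangularBlocks) (x : Fin n → ℝ) :
    η.fstCoordsConj P (η.ofBlocksConj P a *ᵥ x) = η.diagEntries a * η.fstCoordsConj P x := by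
  rw [fstCoordsConj, LinearMap.comp_apply, LinearMap.comp_apply, mulVecLin_apply, mulVecLin_apply,
    mulVec_mulVec, ofBlocksConj_apply, mul_assoc, Units.inv_mul_cancel_left, ← mulVec_mulVec,
    η.fstCoords_mulVec ha]

theorem fstCoordsConj_mulVec_v₀ {a : η.Blocks} (ha : a ∈ η.triangularBlocks) :
    η.fstCoordsConj P (η.ofBlocksConj P a *ᵥ η.v₀ P) = η.diagEntries a := by
  rw [η.fstCoordsConj_mulVec P ha, fstCoordsConj_v₀, mul_one]

/-- The algebra `P 𝒦 P⁻¹` with its scalar part and the cyclic vector `v₀`. -/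
noncomputable def splitting : ScalarSplitting r s (Fin n) where
  alg := η.triangularBlocks.map (η.ofBlocksConj P)
  scalar := (η.ofBlocksConj P).comp η.scalarBlocks
  coord := η.fstCoordsConj P
  vec := η.v₀ P
  scalar_mem z := ⟨_, η.scalarBlocks_mem z, rfl⟩
  scalar_commute z := by
    rintro _ ⟨a, ha, rfl⟩
    exact (η.scalarBlocks_commute z ha).map (η.ofBlocksConj P)
  coord_vec := η.fstCoordsConj_v₀ P
  coord_scalar z := by
    rw [AlgHom.comp_apply, η.fstCoordsConj_mulVec_v₀ P (η.scalarBlocks_mem z),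
      diagEntries_scalarBlocks]
  coord_mulVec := by
    rintro _ ⟨a, ha, rfl⟩ x
    exact (η.fstCoordsConj_mulVec P ha x).trans
      (congrArg (· * _) (η.fstCoordsConj_mulVec_v₀ P ha).symm)
  isNilpotent_sub := by
    rintro _ ⟨a, ha, rfl⟩
    have h := (η.isNilpotent_sub_scalarBlocks ha).map (η.ofBlocksConj P)
    rw [map_sub, ← η.fstCoordsConj_mulVec_v₀ P ha] at h
    exact h

theorem mem_splitting_alg_iff {X : Matrix (Fin n) (Fin n) ℝ} : X ∈ (η.splitting P).alg ↔
    ∃ C ∈ η.normalForm, X = (P : Matrix (Fin n) (Fin n) ℝ) * C *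
      ((P⁻¹ : GL (Fin n) ℝ) : Matrix (Fin n) (Fin n) ℝ) := by
  constructor
  · rintro ⟨a, ha, rfl⟩
    exact ⟨_, η.mem_normalForm_iff.2 ⟨a, ha, rfl⟩, rfl⟩
  · rintro ⟨_, hC, rfl⟩
    obtain ⟨a, ha, rfl⟩ := η.mem_normalForm_iff.1 hC
    exact ⟨a, ha, rfl⟩

theorem mem_splitting_alg_of_conj_mem {X : Matrix (Fin n) (Fin n) ℝ}
    (hX : ((P⁻¹ : GL (Fin n) ℝ) : Matrix (Fin n) (Fin n) ℝ) * X * (P : Matrix (Fin n) (Fin n) ℝ) ∈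
      η.normalForm) : X ∈ (η.splitting P).alg :=
  (η.mem_splitting_alg_iff P).2 ⟨_, hX, by simp [mul_assoc]⟩

theorem logSet_eq (G : Subsemigroup (Matrix (Fin n) (Fin n) ℝ)) :
    η.logSet P G = (η.splitting P).logs G := by
  ext B
  exact and_congr_right fun _ => (η.mem_splitting_alg_iff P).symm

theorem logOrbit_eq (G : Subsemigroup (Matrix (Fin n) (Fin n) ℝ)) (u : Fin n → ℝ) :
    η.logOrbit P G u = (· *ᵥ u) '' (η.splitting P).logs G := by
  ext x
  simp only [logOrbit, logSet_eq, Set.mem_image, Set.mem_ofPred_eq, eq_comm]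

end BlockSizes

theorem orbit_eq {n : ℕ} (G : Subsemigroup (Matrix (Fin n) (Fin n) ℝ)) (u : Fin n → ℝ) :
    orbit G u = (· *ᵥ u) '' (G : Set (Matrix (Fin n) (Fin n) ℝ)) := by
  ext x
  simp only [orbit, Set.mem_image, Set.mem_ofPred_eq, eq_comm, SetLike.mem_coe]

/-- `M - M i i` is nilpotent: on an eigenvector it acts by `μ - M i i`, which must vanish, and its
zero determinant supplies an eigenvector. -/
theorem hasEigenvalue_toLin'_iff_of_mem_triangularSubalgebra {m : ℕ}
    {M : Matrix (Fin m) (Fin m) ℝ} (hM : M ∈ triangularSubalgebra ⊤ m) (i : Fin m) {μ : ℝ} :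
    Module.End.HasEigenvalue (toLin' M) μ ↔ μ = M i i := by
  have hs (v : Fin m → ℝ) : (M - scalar (Fin m) (M i i)) *ᵥ v = M *ᵥ v - M i i • v := by
    rw [sub_mulVec]
    congr 1
    ext j
    simp [mulVec_diagonal]
  constructor
  · intro h
    obtain ⟨v, hv⟩ := h.exists_hasEigenvector
    have h1 : (M - scalar (Fin m) (M i i)) *ᵥ v = (μ - M i i) • v := by
      have h0 : M *ᵥ v = μ • v := hv.apply_eq_smul
      rw [hs, h0, sub_smul]
    have h2 (p : ℕ) : (M - scalar (Fin m) (M i i)) ^ p *ᵥ v = (μ - M i i) ^ p • v := by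
      induction p with
      | zero => simp
      | succ p ih => rw [pow_succ', ← mulVec_mulVec, ih, mulVec_smul, h1, smul_smul, pow_succ]
    have h3 := h2 m
    rw [sub_scalar_pow_eq_zero hM i, zero_mulVec, eq_comm, smul_eq_zero] at h3
    exact sub_eq_zero.1 (eq_zero_of_pow_eq_zero (h3.resolve_right hv.2))
  · rintro rfl
    have : Nonempty (Fin m) := ⟨i⟩
    have hdet : (M - scalar (Fin m) (M i i)).det = 0 := by
      have h := congrArg det (sub_scalar_pow_eq_zero hM i)
      rw [det_pow, det_zero] at h
      exact eq_zero_of_pow_eq_zero h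
    obtain ⟨v, hv, hv'⟩ := exists_mulVec_eq_zero_iff.2 hdet
    refine Module.End.hasEigenvalue_of_hasEigenvector (x := v) ⟨?_, hv⟩
    rw [Module.End.mem_eigenspace_iff, toLin'_apply]
    exact sub_eq_zero.1 ((hs v).symm.trans hv')

namespace BlockSizes

variable {n r s : ℕ} (η : BlockSizes n r s) (P : GL (Fin n) ℝ)

theorem hasEigenvalue_realBlock_iff {X : Matrix (Fin n) (Fin n) ℝ}
    (hX : X ∈ (η.splitting P).alg) (k : Fin r) {μ : ℝ} :
    Module.End.HasEigenvalue (toLin' (η.realBlock (((P⁻¹ : GL (Fin n) ℝ) :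
      Matrix (Fin n) (Fin n) ℝ) * X * (P : Matrix (Fin n) (Fin n) ℝ)) k)) μ ↔
    μ = ((η.splitting P).coord (X *ᵥ (η.splitting P).vec)).1 k := by
  obtain ⟨a, ha, rfl⟩ := hX
  have h1 : ((P⁻¹ : GL (Fin n) ℝ) : Matrix (Fin n) (Fin n) ℝ) * η.ofBlocksConj P a *
      (P : Matrix (Fin n) (Fin n) ℝ) = η.ofBlocks a := by
    simp [ofBlocksConj_apply, mul_assoc]
  have h2 : (η.splitting P).coord (η.ofBlocksConj P a *ᵥ (η.splitting P).vec) =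
    η.diagEntries a := η.fstCoordsConj_mulVec_v₀ P ha
  show Module.End.HasEigenvalue (toLin' (η.realBlock (((P⁻¹ : GL (Fin n) ℝ) :
    Matrix (Fin n) (Fin n) ℝ) * η.ofBlocksConj P a * (P : Matrix (Fin n) (Fin n) ℝ)) k)) μ ↔
    μ = ((η.splitting P).coord (η.ofBlocksConj P a *ᵥ (η.splitting P).vec)).1 k
  rw [h1, h2, realBlock_ofBlocks]
  exact hasEigenvalue_toLin'_iff_of_mem_triangularSubalgebra
    ((η.mem_triangularBlocks.1 ha).1 k) (η.realFst k)

/-- A subset of `Fin r` with `r` elements is everything, and the eigenvalues in `ind` are forced to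
be the real coordinates. -/
theorem ind_eq_iff {G : Subsemigroup (Matrix (Fin n) (Fin n) ℝ)}
    (hK : ∀ A ∈ G, A ∈ (η.splitting P).alg) : η.ind P G = r ↔
      ∀ k, ∃ A ∈ G, IsUnit A ∧ ((η.splitting P).coord (A *ᵥ (η.splitting P).vec)).1 k < 0 ∧
        ∀ i, i ≠ k → 0 < ((η.splitting P).coord (A *ᵥ (η.splitting P).vec)).1 i := by
  have hcard (t : Set (Fin r)) : t.ncard = r ↔ ∀ k, k ∈ t := by
    rw [← Set.eq_univ_iff_forall]
    refine ⟨fun h => ?_, fun h => by simp [h]⟩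
    exact Set.eq_of_subset_of_ncard_le (Set.subset_univ t) (by simp [h])
  rw [ind, hcard]
  refine forall_congr' fun k => exists_congr fun A => and_congr_right fun hA => and_congr_right
    fun _ => ?_
  simp only [η.hasEigenvalue_realBlock_iff P (hK A hA)]
  constructor
  · rintro ⟨μ, hμ, h⟩
    simpa only [hμ] using h
  · exact fun h => ⟨_, fun _ => rfl, h⟩

end BlockSizes

end HypercyclicNormalForm

theorem corollary1p2 (n r s : ℕ) (hn : 1 ≤ n)
    (η : HypercyclicNormalForm.BlockSizes n r s)
    (G : Subsemigroup (Matrix (Fin n) (Fin n) ℝ))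
    (hG : ∀ A ∈ G, ∀ B ∈ G, A * B = B * A)
    (P : GL (Fin n) ℝ)
    (hP : ∀ A ∈ G, ((P⁻¹ : GL (Fin n) ℝ) : Matrix (Fin n) (Fin n) ℝ) * A *
      (P : Matrix (Fin n) (Fin n) ℝ) ∈ η.normalForm) :
    List.TFAE [
      HypercyclicNormalForm.IsHypercyclic G,
      Dense (HypercyclicNormalForm.orbit G (η.v₀ P)),
      ((∀ x ∈ η.logOrbit P G (η.v₀ P), ∀ y ∈ η.logOrbit P G (η.v₀ P),
          x + y ∈ η.logOrbit P G (η.v₀ P)) ∧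
        Dense (η.logOrbit P G (η.v₀ P))) ∧ η.ind P G = r] := by
  have hK : ∀ A ∈ G, A ∈ (η.splitting P).alg := fun A hA =>
    η.mem_splitting_alg_of_conj_mem P (hP A hA)
  rw [η.ind_eq_iff P hK, η.logOrbit_eq, HypercyclicNormalForm.orbit_eq]
  tfae_have 1 → 2 := by
    rintro ⟨v, hv⟩
    rw [HypercyclicNormalForm.orbit_eq] at hv
    exact ScalarSplitting.dense_orbit_vec_of_dense_orbit (K := η.splitting P) hG hK hv
  tfae_have 2 → 1 := fun h => ⟨η.v₀ P, by rwa [HypercyclicNormalForm.orbit_eq]⟩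
  tfae_have 2 → 3 := fun h => by
    refine ⟨⟨?_, ScalarSplitting.dense_logs_of_dense_orbit (K := η.splitting P) hG hK h⟩,
      ScalarSplitting.exists_sign_of_dense_orbit (K := η.splitting P) hK h⟩
    rintro _ ⟨B, hB, rfl⟩ _ ⟨C, hC, rfl⟩
    exact ⟨B + C, ScalarSplitting.add_mem_logs hG hK hB hC, Matrix.add_mulVec _ _ _⟩
  tfae_have 3 → 2 := fun h =>
    ScalarSplitting.dense_orbit_of_dense_logs (K := η.splitting P) hG hK h.1.2 h.2
  tfae_finish
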